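/- For a real random variable $X$ and an integer $n\ge 1$ with $\mathsf{E}|X|^n<\infty$, let $m_k=\mathsf{E}[X^k]$ for $1\le k\le n$, and let the $n$-th cumulant of $X$ be \[ \kappa_n(X)=\sum_{\pi\in\mathcal P(n)}(-1)^{|\pi|-1}(|\pi|-1)!\prod_{B\in\pi}m_{|B|}, \] where $\mathcal P(n)$ is the set of all partitions of $\{1,\dots,n\}$ into nonempty blocks and $|\pi|$ is the number of blocks of $\pi$. Put \[ C_{\mathrm{sym}}(n)=\sum_{\substack{\pi\in\mathcal P(n)\\ |B|\text{ even for all }B\in\pi}}(|\pi|-1)!. \] Let $X$ be a real random variable that is symmetric about the origin, that is, $X$ and $-X$ have the same distribution. (i) If $n\ge 1$ is odd and $\mathsf{E}|X|^n<\infty$, then $\kappa_n(X)=0$. (ii) If $m\ge 1$ and $\mathsf{E}|X|^{2m}<\infty$, then $|\kappa_{2m}(X)|\le C_{\mathrm{sym}}(2m)\,\mathsf{E}|X|^{2m}$. Moreover, with $\rho_{\mathrm{sym}}=\operatorname{arcosh}2\approx 1.317$ (so $|\rho_{\mathrm{sym}}-1.317|<0.0005$), \[ C_{\mathrm{sym}}(2m)\sim\frac{2\,(2m-1)!}{\rho_{\mathrm{sym}}^{2m}}\qquad(m\to\infty).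 \] -/

import Mathlib

open MeasureTheory ProbabilityTheory Filter Asymptotics
open scoped Nat

/-- The `n`-th cumulant of a real random variable `X`, by the moment-cumulant formula: the sum over
all set partitions `π` of an `n`-element set of `(-1)^(|π|-1) (|π|-1)!` times the product over the
blocks `B` of the raw moments `E[X ^ |B|]`. It is meant for `n ≥ 1` (so that `|π| ≥ 1`) and for
`X` with a finite absolute moment of order `n`. -/
noncomputable def cumulant {Ω : Type*} [MeasurableSpace Ω] (X : Ω → ℝ) (n : ℕ) (μ : Measure Ω) : ℝ :=
  ∑ π : Finpartition (Finset.univ : Finset (Fin n)),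
    (-1 : ℝ) ^ (π.parts.card - 1) * ((π.parts.card - 1)! : ℝ) * ∏ B ∈ π.parts, moment X B.card μ

/-- The sum of `(|π|-1)!` over the set partitions `π` of an `n`-element set all of whose blocks
have even size. -/
def Csym (n : ℕ) : ℕ :=
  ∑ π : Finpartition (Finset.univ : Finset (Fin n)) with ∀ B ∈ π.parts, Even B.card,
    (π.parts.card - 1)!

/-- The rate `ρ_sym = arcosh 2`. -/
noncomputable def rhoSym : ℝ := Real.arcosh 2

/-!
A partition of an odd-sized set has an odd block, and odd moments of a symmetric variable vanish;
this gives (i), and leaves in `κ_{2m}` only the partitions into even blocks. By Lyapunov's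
inequality `|m_k| ≤ (E|X|ⁿ)^{k/n}`, each product of moments is at most `E|X|ⁿ`, which gives (ii).

For the asymptotics, the exponential generating function of `C_sym` is `L = -log (2 - cosh x)`.
Writing `W = cosh x - 1`, the identity `x L' = x W' + W · x L'` says that
`u_m = 2m C_sym(2m) ρ^{2m} / (2m)!` solves the renewal equation with waiting law
`p_m = ρ^{2m} / (2m)!` (`m ≥ 1`) and source `2m p_m`. The law has mass `cosh ρ - 1 = 1` exactly when
`ρ = arcosh 2`, and its mean `M = (ρ / 2) sinh ρ` is less than `2`; hence `u_m → 2M / M = 2`.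
-/
section CyclicPartitionSum

open Finset

theorem sum_powerset_eq_of_card_eq {α β M : Type*} [AddCommMonoid M] {s : Finset α} {t : Finset β}
    (hst : #s = #t) {f : Finset α → M} {g : Finset β → M}
    (hfg : ∀ A ⊆ s, ∀ B ⊆ t, #A = #B → f A = g B) :
    ∑ A ∈ s.powerset, f A = ∑ B ∈ t.powerset, g B := by
  rw [sum_powerset, sum_powerset, hst]
  refine sum_congr rfl fun j hj => ?_
  rw [mem_range_succ_iff] at hj
  obtain ⟨A₀, hA₀⟩ := powersetCard_nonempty.2 (hst ▸ hj)
  have hA₀' := mem_powersetCard.1 hA₀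
  have hg : ∀ B ∈ powersetCard j t, g B = f A₀ := fun B hB => by
    rw [mem_powersetCard] at hB
    exact (hfg A₀ hA₀'.1 B hB.1 (hA₀'.2.trans hB.2.symm)).symm
  obtain ⟨B₀, hB₀⟩ := powersetCard_nonempty.2 hj
  have hf : ∀ A ∈ powersetCard j s, f A = f A₀ := fun A hA => by
    rw [← hg B₀ hB₀]
    rw [mem_powersetCard] at hA hB₀
    exact hfg A hA.1 B₀ hB₀.1 (hA.2.trans hB₀.2.symm)
  rw [sum_eq_card_nsmul hf, sum_eq_card_nsmul hg, card_powersetCard, card_powersetCard, hst]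

variable {α β : Type*} [DecidableEq α] [DecidableEq β]

theorem parts_avoid_of_mem {s B : Finset α} (π : Finpartition s) (hB : B ∈ π.parts) :
    (π.avoid B).parts = π.parts.erase B := by
  ext C
  rw [Finpartition.mem_avoid, mem_erase]
  constructor
  · rintro ⟨D, hD, hDB, rfl⟩
    have hne : D ≠ B := fun h => hDB h.le
    have hdisj : Disjoint D B := π.disjoint hD hB hne
    rw [sdiff_eq_self_of_disjoint hdisj]
    exact ⟨hne, hD⟩
  · rintro ⟨hne, hC⟩
    have hdisj : Disjoint C B := π.disjoint hC hB hne
    exact ⟨C, hC, fun h => π.ne_bot hC (hdisj.eq_bot_of_le h), sdiff_eq_self_of_disjoint hdisj⟩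

/-- Adjoins the nonempty block `B ⊆ s` to a partition of `s \ B`; inverse to removing a block with
`Finpartition.avoid`. -/
def adjoinBlock {s B : Finset α} (hBs : B ⊆ s) (hB : B.Nonempty) (π : Finpartition (s \ B)) :
    Finpartition s :=
  π.extend hB.ne_empty sdiff_disjoint (sdiff_union_of_subset hBs)

theorem avoid_adjoinBlock {s B : Finset α} (hBs : B ⊆ s) (hB : B.Nonempty)
    (π : Finpartition (s \ B)) : (adjoinBlock hBs hB π).avoid B = π := by
  have hBπ : B ∉ π.parts := fun h =>
    hB.ne_empty (sdiff_disjoint.symm.eq_bot_of_le (π.le h))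
  ext1
  rw [parts_avoid_of_mem _ (mem_insert_self _ _)]
  exact erase_insert hBπ

theorem adjoinBlock_avoid {s B : Finset α} (π : Finpartition s) (hB : B ∈ π.parts) :
    adjoinBlock (π.le hB) (π.nonempty_of_mem_parts hB) (π.avoid B) = π := by
  ext1
  rw [adjoinBlock, Finpartition.extend_parts, parts_avoid_of_mem π hB, insert_erase hB]

theorem sum_finpartition_sum_parts {M : Type*} [AddCommMonoid M] (s : Finset α)
    (f : ∀ B : Finset α, Finpartition (s \ B) → M) :
    ∑ π : Finpartition s, ∑ B ∈ π.parts, f B (π.avoid B) =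
      ∑ B ∈ s.powerset with B.Nonempty, ∑ π : Finpartition (s \ B), f B π := by
  rw [sum_sigma', sum_sigma']
  have subset_and_nonempty {y : Σ B : Finset α, Finpartition (s \ B)}
      (hy : y ∈ ({B ∈ s.powerset | B.Nonempty} : Finset _).sigma fun _ => univ) :
      y.1 ⊆ s ∧ y.1.Nonempty := by
    simpa using hy
  refine sum_bij' (fun x _ => ⟨x.2, x.1.avoid x.2⟩)
    (fun y hy => ⟨adjoinBlock (subset_and_nonempty hy).1 (subset_and_nonempty hy).2 y.2, y.1⟩)
    ?_ ?_ ?_ ?_ fun _ _ => rfl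
  · rintro ⟨π, B⟩ h
    have hB : B ∈ π.parts := by simpa using h
    simpa using ⟨π.le hB, π.nonempty_of_mem_parts hB⟩
  · rintro ⟨B, π⟩ h
    exact mem_sigma.2 ⟨mem_univ _, mem_insert_self B π.parts⟩
  · rintro ⟨π, B⟩ h
    have hB : B ∈ π.parts := by simpa using h
    exact Sigma.ext (adjoinBlock_avoid π hB) HEq.rfl
  · rintro ⟨B, π⟩ h
    obtain ⟨hBs, hB⟩ := subset_and_nonempty h
    exact Sigma.ext rfl (heq_of_eq (avoid_adjoinBlock hBs hB π))

theorem sum_card_sdiff_parts {s : Finset α} (π : Finpartition s) :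
    ∑ B ∈ π.parts, #(s \ B) = (#π.parts - 1) * #s := by
  have h : ∑ B ∈ π.parts, #(s \ B) + #s = #π.parts * #s := by
    conv_lhs => rw [← π.sum_card_parts, ← sum_add_distrib]
    exact sum_const_nat fun B hB => card_sdiff_add_card_eq_card (π.le hB)
  rw [Nat.sub_mul, one_mul, ← h, Nat.add_sub_cancel]

theorem card_mul_factorial_card_parts_sub_one {s : Finset α} (π : Finpartition s) :
    #s * (#π.parts - 1)! =
      (if #π.parts = 1 then #s else 0) + ∑ B ∈ π.parts, #(s \ B) * (#π.parts - 2)! := by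
  rw [← sum_mul, sum_card_sdiff_parts]
  rcases hk : #π.parts with _ | _ | k
  · have hs : s = ∅ := π.parts_eq_empty_iff.1 (card_eq_zero.1 hk)
    simp [hs]
  · simp
  · rw [if_neg (by omega), zero_add, Nat.add_sub_cancel, Nat.factorial_succ,
      show k + 1 + 1 - 2 = k from rfl]
    ring

theorem card_parts_eq_one_iff {s : Finset α} (hs : s ≠ ⊥) (π : Finpartition s) :
    #π.parts = 1 ↔ π = Finpartition.indiscrete hs := by
  refine ⟨fun h => ?_, fun h => h ▸ card_singleton s⟩
  obtain ⟨B, hB⟩ := card_eq_one.1 h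
  have hBs : B = s := by simpa [hB] using π.sup_parts
  ext1
  rw [hB, hBs, Finpartition.indiscrete_parts]

variable {R : Type*} [CommSemiring R]

/-- The weighted number of set partitions of `s` whose blocks are arranged in a cycle, a block of
size `k` having weight `w k`. If `w` has exponential generating function `W`, the sums over
`n`-element sets, `n ≥ 1`, have exponential generating function `-log (1 - W)`; on `s = ∅` the
truncated `0 - 1 = 0` gives the value `1`. -/
def cyclicPartitionSum (w : ℕ → R) (s : Finset α) : R :=
  ∑ π : Finpartition s, ((#π.parts - 1)! : R) * ∏ B ∈ π.parts, w #B

theorem cyclicPartitionSum_empty (w : ℕ → R) : cyclicPartitionSum w (∅ : Finset α) = 1 := by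
  rw [cyclicPartitionSum, ← bot_eq_empty, Fintype.sum_unique, Finpartition.default_eq_empty]
  simp

theorem sum_finpartition_ite_card_parts_eq_one (w : ℕ → R) (s : Finset α) :
    ∑ π : Finpartition s, (if #π.parts = 1 then (#s : R) else 0) * ∏ B ∈ π.parts, w #B =
      #s * w #s := by
  rcases eq_or_ne s ∅ with rfl | hs
  · simp
  · simp [card_parts_eq_one_iff hs, ite_mul]

/-- The coefficientwise form of `x L' = x W' + W · x L'` for `L = -log (1 - W)`. -/
theorem card_mul_cyclicPartitionSum {w : ℕ → R} (hw : w 0 = 0) (s : Finset α) :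
    #s * cyclicPartitionSum w s = #s * w #s +
      ∑ B ∈ s.powerset, w #B * (#(s \ B) * cyclicPartitionSum w (s \ B)) := by
  have hsplit : ∑ B ∈ s.powerset, w #B * (#(s \ B) * cyclicPartitionSum w (s \ B)) =
      ∑ π : Finpartition s, (∑ B ∈ π.parts, #(s \ B) * ((#π.parts - 2)! : R)) *
        ∏ B ∈ π.parts, w #B := by
    calc _ = ∑ B ∈ s.powerset with B.Nonempty, ∑ π : Finpartition (s \ B),
          w #B * (#(s \ B) * (((#π.parts - 1)! : R) * ∏ C ∈ π.parts, w #C)) := by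
          simp only [cyclicPartitionSum, mul_sum]
          refine (sum_filter_of_ne fun B _ h => ?_).symm
          contrapose! h
          simp [h, hw]
      _ = _ := by
          rw [← sum_finpartition_sum_parts]
          refine sum_congr rfl fun π _ => ?_
          rw [sum_mul]
          refine sum_congr rfl fun B hB => ?_
          rw [parts_avoid_of_mem π hB, card_erase_of_mem hB, ← mul_prod_erase _ _ hB, Nat.sub_sub]
          ring
  rw [hsplit, ← sum_finpartition_ite_card_parts_eq_one, ← sum_add_distrib, cyclicPartitionSum,
    mul_sum]
  refine sum_congr rfl fun π _ => ?_
  rw [← add_mul, ← mul_assoc]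
  congr 1
  exact_mod_cast congrArg (Nat.cast : ℕ → R) (card_mul_factorial_card_parts_sub_one π)

theorem cyclicPartitionSum_eq_of_card_eq [IsCancelMulZero R] [CharZero R] {w : ℕ → R}
    (hw : w 0 = 0) {s : Finset α} {t : Finset β} (hst : #s = #t) :
    cyclicPartitionSum w s = cyclicPartitionSum w t := by
  induction hn : #s using Nat.strong_induction_on generalizing s t with
  | _ n ih =>
    subst hn
    rcases s.eq_empty_or_nonempty with rfl | hs
    · obtain rfl : t = ∅ := card_eq_zero.1 hst.symm
      rw [cyclicPartitionSum_empty, cyclicPartitionSum_empty]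
    have hs0 : (#s : R) ≠ 0 := Nat.cast_ne_zero.2 hs.card_ne_zero
    refine mul_left_cancel₀ hs0 ?_
    nth_rw 2 [hst]
    rw [card_mul_cyclicPartitionSum hw s, card_mul_cyclicPartitionSum hw t, hst]
    congr 1
    refine sum_powerset_eq_of_card_eq hst fun A hA B hB hAB => ?_
    rcases A.eq_empty_or_nonempty with rfl | hA0
    · simp [← hAB, hw]
    have hcard : #(s \ A) = #(t \ B) := by
      rw [card_sdiff_of_subset hA, card_sdiff_of_subset hB, hst, hAB]
    rw [hAB, hcard, ih _ (card_lt_card (sdiff_ssubset hA hA0)) hcard rfl]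

end CyclicPartitionSum

section Renewal

open Finset PowerSeries

theorem sum_range_sum_antidiagonal_le {a b : ℕ → ℝ} (ha : ∀ n, 0 ≤ a n) (hb : ∀ n, 0 ≤ b n)
    (N : ℕ) :
    ∑ n ∈ range N, ∑ ij ∈ antidiagonal n, a ij.1 * b ij.2 ≤
      (∑ n ∈ range N, a n) * ∑ n ∈ range N, b n := by
  simp only [Nat.sum_antidiagonal_eq_sum_range_succ fun i j => a i * b j]
  rw [sum_range_diag_flip N fun i j => a i * b j, sum_mul_sum]
  gcongr with i
  · exact fun _ _ _ => mul_nonneg (ha _) (hb _)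
  · exact Nat.sub_le N i

/-- The point is that `1 - A` is invertible in the convolution algebra `ℓ¹`. -/
theorem summable_norm_coeff_of_eq_add_mul {R : Type*} [NormedRing R] {A G D : R⟦X⟧}
    (hD : D = G + A * D) (hA : Summable fun n => ‖coeff n A‖) (hA1 : ∑' n, ‖coeff n A‖ < 1)
    (hG : Summable fun n => ‖coeff n G‖) : Summable fun n => ‖coeff n D‖ := by
  set θ := ∑' n, ‖coeff n A‖
  have hpointwise (n : ℕ) : ‖coeff n D‖ ≤
      ‖coeff n G‖ + ∑ ij ∈ antidiagonal n, ‖coeff ij.1 A‖ * ‖coeff ij.2 D‖ := by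
    conv_lhs => rw [hD, map_add, coeff_mul]
    exact (norm_add_le _ _).trans
      (add_le_add_right (norm_sum_le_of_le _ fun _ _ => norm_mul_le _ _) _)
  refine summable_of_sum_range_le (c := (∑' n, ‖coeff n G‖) / (1 - θ)) (fun _ => norm_nonneg _)
    fun N => ?_
  have hpartial : ∑ n ∈ range N, ‖coeff n D‖ ≤
      ∑' n, ‖coeff n G‖ + θ * ∑ n ∈ range N, ‖coeff n D‖ :=
    calc _ ≤ ∑ n ∈ range N, ‖coeff n G‖ +
          ∑ n ∈ range N, ∑ ij ∈ antidiagonal n, ‖coeff ij.1 A‖ * ‖coeff ij.2 D‖ := by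
          rw [← sum_add_distrib]
          exact sum_le_sum fun n _ => hpointwise n
      _ ≤ ∑ n ∈ range N, ‖coeff n G‖ +
          (∑ n ∈ range N, ‖coeff n A‖) * ∑ n ∈ range N, ‖coeff n D‖ := by
          gcongr
          exact sum_range_sum_antidiagonal_le (a := fun n => ‖coeff n A‖)
            (b := fun n => ‖coeff n D‖) (fun _ => norm_nonneg _) (fun _ => norm_nonneg _) N
      _ ≤ _ := by
          gcongr
          · exact hG.sum_le_tsum _ fun _ _ => norm_nonneg _
          · exact hA.sum_le_tsum _ fun _ _ => norm_nonneg _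
  rw [le_div_iff₀ (sub_pos.2 hA1)]
  linarith

theorem sum_range_succ_coeff_one_sub_X_mul {R : Type*} [Ring R] (U : R⟦X⟧) (n : ℕ) :
    ∑ k ∈ range (n + 1), coeff k ((1 - X) * U) = coeff n U := by
  induction n with
  | zero => simp [sub_mul]
  | succ n ih =>
    rw [sum_range_succ, ih, sub_mul, map_sub, one_mul, coeff_succ_X_mul, add_sub_cancel]

/-- The tail sums `k ↦ ∑_{n > k} p n`; for the law `p` of a waiting time `T` these are the
probabilities `P(T > k)`. -/
noncomputable def tailSum (p : ℕ → ℝ) (k : ℕ) : ℝ := ∑' i, p (k + 1 + i)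

variable {p : ℕ → ℝ}

theorem tailSum_nonneg (hp : ∀ n, 0 ≤ p n) (k : ℕ) : 0 ≤ tailSum p k :=
  tsum_nonneg fun _ => hp _

theorem tailSum_eq_add_tailSum_succ (hp : Summable p) (k : ℕ) :
    tailSum p k = p (k + 1) + tailSum p (k + 1) := by
  have hs : Summable fun i => p (k + 1 + i) := by
    simpa only [add_comm] using (summable_nat_add_iff (k + 1)).2 hp
  rw [tailSum, hs.tsum_eq_zero_add, add_zero, tailSum]
  simp only [add_right_comm (k + 1) 1, add_assoc (k + 1)]

theorem tailSum_zero (hp : HasSum p 1) : tailSum p 0 = 1 - p 0 := by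
  have h := hp.summable.tsum_eq_zero_add
  rw [hp.tsum_eq] at h
  simp only [tailSum, zero_add, add_comm 1]
  linarith

theorem one_sub_X_mul_mk_tailSum (hp : HasSum p 1) :
    (1 - X) * PowerSeries.mk (tailSum p) = 1 - PowerSeries.mk p := by
  ext (_ | k)
  · simp [sub_mul, tailSum_zero hp]
  · simp [sub_mul, coeff_succ_X_mul, coeff_one, tailSum_eq_add_tailSum_succ hp.summable k]

theorem hasSum_tailSum {M : ℝ} (hp : ∀ n, 0 ≤ p n) (hM : HasSum (fun n : ℕ => n * p n) M) :
    HasSum (tailSum p) M := by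
  have hM' : HasSum (fun n : ℕ => (n + 1) * p (n + 1)) M := by
    simpa using (hasSum_nat_add_iff' 1).2 hM
  have hfiber (n : ℕ) : HasSum (fun _ : antidiagonal n => p (n + 1)) ((n + 1) * p (n + 1)) := by
    simpa using hasSum_fintype fun _ : antidiagonal n => p (n + 1)
  have hsummable : Summable fun x : Σ n : ℕ, antidiagonal n => p (x.1 + 1) := by
    refine (summable_sigma_of_nonneg fun x => hp _).2 ⟨fun n => (hfiber n).summable, ?_⟩
    simpa only [(hfiber _).tsum_eq] using hM'.summable
  have hsigma : HasSum (fun x : Σ n : ℕ, antidiagonal n => p (x.1 + 1)) M :=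
    hM'.unique (hsummable.hasSum.sigma hfiber) ▸ hsummable.hasSum
  have hprod : HasSum (fun x : ℕ × ℕ => p (x.1 + 1 + x.2)) M := by
    simp only [add_right_comm]
    exact HasAntidiagonal.sigmaAntidiagonalEquivProd.symm.hasSum_iff.2 hsigma
  exact hprod.prod_fiberwise fun k => (hprod.summable.prod_factor k).hasSum

theorem one_le_mean {M : ℝ} (hp : ∀ n, 0 ≤ p n) (hp0 : p 0 = 0) (hp1 : HasSum p 1)
    (hM : HasSum (fun n : ℕ => n * p n) M) : 1 ≤ M := by
  refine hasSum_le (fun n => ?_) hp1 hM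
  rcases n.eq_zero_or_pos with rfl | hn
  · simp [hp0]
  · exact le_mul_of_one_le_left (hp n) (Nat.one_le_cast.2 hn)

theorem hasSum_norm_coeff_one_sub_mk_tailSum {M : ℝ} (hp : ∀ n, 0 ≤ p n) (hp0 : p 0 = 0)
    (hp1 : HasSum p 1) (hM : HasSum (fun n : ℕ => n * p n) M) :
    HasSum (fun n => ‖coeff n (1 - PowerSeries.mk (tailSum p))‖) (M - 1) := by
  convert! (hasSum_tailSum hp hM).sub (hasSum_ite_eq 0 (1 : ℝ)) using 2 with n
  rcases eq_or_ne n 0 with rfl | hn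
  · simp [tailSum_zero hp1, hp0]
  · simp [coeff_one, hn, abs_of_nonneg (tailSum_nonneg hp n)]

/-- A renewal theorem. With `U`, `G`, `P` the generating functions of `u`, `g`, `p` and `R` that of
the tails of `p`, the equation `U = G + P U` reads `R · (1 - X) U = G`, and a mean less than `2`
makes `R` invertible in `ℓ¹`; so the increments of `u` are summable. -/
theorem tendsto_of_renewal {g u : ℕ → ℝ} {M : ℝ} (hp : ∀ n, 0 ≤ p n) (hp0 : p 0 = 0)
    (hp1 : HasSum p 1) (hM : HasSum (fun n : ℕ => n * p n) M) (hM2 : M < 2)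
    (hg : Summable fun n => ‖g n‖)
    (hu : ∀ n, u n = g n + ∑ ij ∈ antidiagonal n, p ij.1 * u ij.2) :
    Tendsto u atTop (nhds ((∑' n, g n) / M)) := by
  set R := PowerSeries.mk (tailSum p)
  set D := (1 - X) * PowerSeries.mk u
  have hU : PowerSeries.mk u = PowerSeries.mk g + PowerSeries.mk p * PowerSeries.mk u := by
    ext n
    simpa [coeff_mul] using hu n
  have hRD : R * D = PowerSeries.mk g := by
    linear_combination hU + PowerSeries.mk u * one_sub_X_mul_mk_tailSum hp1
  have hR := hasSum_norm_coeff_one_sub_mk_tailSum hp hp0 hp1 hM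
  have hDsum : Summable fun n => ‖coeff n D‖ :=
    summable_norm_coeff_of_eq_add_mul (A := 1 - R) (G := PowerSeries.mk g)
      (by linear_combination hRD) hR.summable (by rw [hR.tsum_eq]; linarith) (by simpa using hg)
  have htail := hasSum_tailSum hp hM
  have hprod : M * ∑' n, coeff n D = ∑' n, g n := by
    have hcauchy := tsum_mul_tsum_eq_tsum_sum_antidiagonal_of_summable_norm
      htail.summable.norm hDsum
    rw [← htail.tsum_eq, hcauchy]
    refine tsum_congr fun n => ?_
    simpa [R, coeff_mul] using congrArg (coeff n) hRD
  have hM0 : M ≠ 0 := (one_pos.trans_le (one_le_mean hp hp0 hp1 hM)).ne'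
  rw [← hprod, mul_div_cancel_left₀ _ hM0]
  have hlim := (tendsto_add_atTop_iff_nat 1).2 hDsum.of_norm.hasSum.tendsto_sum_nat
  simpa only [D, sum_range_succ_coeff_one_sub_X_mul, coeff_mk] using hlim

end Renewal

section Asymptotics

open Finset

theorem mul_cyclicPartitionSum_univ_fin {R : Type*} [CommSemiring R] [IsCancelMulZero R]
    [CharZero R] {w : ℕ → R} (hw : w 0 = 0) (n : ℕ) :
    n * cyclicPartitionSum w (univ : Finset (Fin n)) = n * w n +
      ∑ ij ∈ antidiagonal n, n.choose ij.1 *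
        (w ij.1 * (ij.2 * cyclicPartitionSum w (univ : Finset (Fin ij.2)))) := by
  have hcompl (B : Finset (Fin n)) : #(univ \ B) = n - #B := by
    rw [card_sdiff_of_subset (subset_univ B), card_fin]
  have hblock (B : Finset (Fin n)) : cyclicPartitionSum w (univ \ B) =
      cyclicPartitionSum w (univ : Finset (Fin (n - #B))) :=
    cyclicPartitionSum_eq_of_card_eq hw (by rw [hcompl, card_fin])
  have hrec := card_mul_cyclicPartitionSum hw (univ : Finset (Fin n))
  simp only [hcompl, hblock, card_fin] at hrec
  rw [hrec, sum_powerset_apply_card fun k =>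
      w k * ((n - k : ℕ) * cyclicPartitionSum w (univ : Finset (Fin (n - k)))), card_fin]
  simp only [nsmul_eq_mul]
  rw [Nat.sum_antidiagonal_eq_sum_range_succ fun i j =>
    (n.choose i : R) * (w i * (j * cyclicPartitionSum w (univ : Finset (Fin j))))]

theorem mul_cyclicPartitionSum_div_factorial {K : Type*} [Field K] [CharZero K] {w : ℕ → K}
    (hw : w 0 = 0) (x : K) (n : ℕ) :
    n * (cyclicPartitionSum w (univ : Finset (Fin n)) * x ^ n / n !) = n * (w n * x ^ n / n !) +
      ∑ ij ∈ antidiagonal n, w ij.1 * x ^ ij.1 / ij.1 ! *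
        (ij.2 * (cyclicPartitionSum w (univ : Finset (Fin ij.2)) * x ^ ij.2 / ij.2 !)) := by
  rw [mul_div_assoc, ← mul_assoc, mul_cyclicPartitionSum_univ_fin hw, add_mul, sum_mul]
  congr 1
  · ring
  · refine sum_congr rfl fun ⟨i, j⟩ hij => ?_
    obtain rfl : i + j = n := HasAntidiagonal.mem_antidiagonal.1 hij
    have hfac : ((i + j)! : K) ≠ 0 := Nat.cast_ne_zero.2 (Nat.factorial_ne_zero _)
    rw [Nat.cast_add_choose, pow_add]
    field_simp

theorem sum_antidiagonal_mul_of_dvd {M : Type*} [AddCommMonoid M] {d : ℕ} (hd : d ≠ 0)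
    {f : ℕ → ℕ → M} (hf : ∀ i j, ¬d ∣ i → f i j = 0) (m : ℕ) :
    ∑ ij ∈ antidiagonal (d * m), f ij.1 ij.2 =
      ∑ ij ∈ antidiagonal m, f (d * ij.1) (d * ij.2) := by
  symm
  refine sum_of_injOn (fun ij => (d * ij.1, d * ij.2)) ?_ ?_ ?_ fun _ _ => rfl
  · rintro ⟨i, j⟩ - ⟨i', j'⟩ - h
    simpa [hd] using h
  · rintro ⟨i, j⟩ hij
    simpa [← mul_add, hd] using hij
  · rintro ⟨i, j⟩ hij hnotMem
    refine hf i j fun ⟨i', hi'⟩ => hnotMem ?_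
    obtain rfl : i = d * i' := hi'
    rw [HasAntidiagonal.mem_antidiagonal] at hij
    obtain ⟨j', rfl⟩ : d ∣ j := (Nat.dvd_add_right (dvd_mul_right d i')).1 (hij ▸ dvd_mul_right d m)
    exact ⟨(i', j'), by simpa [← mul_add, hd] using hij, rfl⟩

theorem tendsto_cyclicPartitionSum_mul_pow_div_factorial {w : ℕ → ℝ} {d : ℕ} {ρ M : ℝ}
    (hd : d ≠ 0) (hw : ∀ n, 0 ≤ w n) (hw0 : w 0 = 0) (hwd : ∀ n, ¬d ∣ n → w n = 0) (hρ : 0 ≤ ρ)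
    (hmass : HasSum (fun m : ℕ => w (d * m) * ρ ^ (d * m) / (d * m)!) 1)
    (hmean : HasSum (fun m : ℕ => m * (w (d * m) * ρ ^ (d * m) / (d * m)!)) M) (hM : M < 2) :
    Tendsto (fun m : ℕ => ((d * m : ℕ) : ℝ) *
      (cyclicPartitionSum w (univ : Finset (Fin (d * m))) * ρ ^ (d * m) / (d * m)!))
      atTop (nhds d) := by
  have hp (m : ℕ) : 0 ≤ w (d * m) * ρ ^ (d * m) / (d * m)! :=
    div_nonneg (mul_nonneg (hw _) (pow_nonneg hρ _)) (Nat.cast_nonneg _)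
  have hp0 : w (d * 0) * ρ ^ (d * 0) / (d * 0)! = 0 := by simp [hw0]
  have hM0 : M ≠ 0 := (one_pos.trans_le (one_le_mean hp hp0 hmass hmean)).ne'
  have hg : HasSum (fun m : ℕ => ((d * m : ℕ) : ℝ) * (w (d * m) * ρ ^ (d * m) / (d * m)!))
      (d * M) := by
    simpa only [Nat.cast_mul, mul_assoc] using hmean.mul_left (d : ℝ)
  have hlim := tendsto_of_renewal (u := fun m : ℕ => ((d * m : ℕ) : ℝ) *
      (cyclicPartitionSum w (univ : Finset (Fin (d * m))) * ρ ^ (d * m) / (d * m)!))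
      hp hp0 hmass hmean hM hg.summable.norm fun m => by
    rw [mul_cyclicPartitionSum_div_factorial hw0 ρ (d * m)]
    congr 1
    exact sum_antidiagonal_mul_of_dvd hd (f := fun i j => w i * ρ ^ i / i ! *
      (j * (cyclicPartitionSum w (univ : Finset (Fin j)) * ρ ^ j / j !)))
      (fun i j hi => by simp [hwd i hi]) m
  rwa [hg.tsum_eq, mul_div_cancel_right₀ _ hM0] at hlim

/-- The block weight singling out the nonempty blocks of even size, which turns
`cyclicPartitionSum` into `Csym`; its exponential generating function is `cosh x - 1`. -/
noncomputable def evenWeight (n : ℕ) : ℝ := if n ≠ 0 ∧ Even n then 1 else 0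

theorem Csym_eq_cyclicPartitionSum (n : ℕ) :
    (Csym n : ℝ) = cyclicPartitionSum evenWeight (univ : Finset (Fin n)) := by
  have hprod (π : Finpartition (univ : Finset (Fin n))) :
      ∏ B ∈ π.parts, evenWeight #B = if ∀ B ∈ π.parts, Even #B then 1 else 0 := by
    simp only [evenWeight, prod_ite_zero, prod_const_one]
    refine if_congr (forall₂_congr fun B hB => ?_) rfl rfl
    simp [π.ne_empty hB]
  rw [Csym, sum_filter, Nat.cast_sum, cyclicPartitionSum]
  refine Fintype.sum_congr _ _ fun π => ?_
  rw [hprod, mul_ite, mul_one, mul_zero, Nat.cast_ite, Nat.cast_zero]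

theorem hasSum_evenWeight_mul_pow_div_factorial (x : ℝ) :
    HasSum (fun m : ℕ => evenWeight (2 * m) * x ^ (2 * m) / (2 * m)!) (Real.cosh x - 1) := by
  convert! (Real.hasSum_cosh x).sub (hasSum_ite_eq 0 (1 : ℝ)) using 2 with m
  rcases eq_or_ne m 0 with rfl | hm
  · simp [evenWeight]
  · simp [evenWeight, hm]

theorem hasSum_mul_evenWeight_mul_pow_div_factorial (x : ℝ) :
    HasSum (fun m : ℕ => m * (evenWeight (2 * m) * x ^ (2 * m) / (2 * m)!))
      (x / 2 * Real.sinh x) := by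
  refine (hasSum_nat_add_iff' 1).1 ?_
  simp only [range_one, sum_singleton, Nat.cast_zero, zero_mul, sub_zero]
  convert! (Real.hasSum_sinh x).mul_left (x / 2) using 2 with m
  have hweight : evenWeight (2 * (m + 1)) = 1 := by simp [evenWeight]
  rw [hweight, show 2 * (m + 1) = 2 * m + 1 + 1 by ring, Nat.factorial_succ (2 * m + 1)]
  push_cast
  field_simp
  ring

theorem rhoSym_pos : 0 < rhoSym := Real.arcosh_pos one_lt_two

theorem exp_rhoSym : Real.exp rhoSym = 2 + √3 := by
  rw [rhoSym, Real.exp_arcosh one_le_two]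
  norm_num

theorem cosh_rhoSym : Real.cosh rhoSym = 2 := Real.cosh_arcosh one_le_two

theorem sinh_rhoSym : Real.sinh rhoSym = √3 := by
  rw [rhoSym, Real.sinh_arcosh one_le_two]
  norm_num

theorem rhoSym_lt : rhoSym < 1.3175 := by
  have hsqrt : √3 < 1.7321 := by
    rw [Real.sqrt_lt' (by norm_num)]
    norm_num
  have htaylor := Real.sum_le_exp_of_nonneg (x := 1.3175) (by norm_num) 10
  norm_num [sum_range_succ, Nat.factorial] at htaylor
  rw [← Real.exp_lt_exp, exp_rhoSym]
  linarith

theorem lt_rhoSym : 1.3165 < rhoSym := by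
  have hsqrt : 1.732 < √3 := by
    rw [Real.lt_sqrt (by norm_num)]
    norm_num
  -- The Taylor bound needs an argument in `[0, 1]`, hence the halved exponent.
  have htaylor : Real.exp 0.65825 ≤ 1.9315 := by
    refine (Real.exp_bound' (n := 8) (by norm_num) (by norm_num) (by norm_num)).trans ?_
    norm_num [sum_range_succ, Nat.factorial]
  rw [← Real.exp_lt_exp, exp_rhoSym]
  calc Real.exp 1.3165 = Real.exp 0.65825 ^ 2 := by
        rw [← Real.exp_nat_mul]
        norm_num
    _ ≤ 1.9315 ^ 2 := by gcongr
    _ < 2 + √3 := by linarith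

theorem rhoSym_div_two_mul_sinh_lt_two : rhoSym / 2 * Real.sinh rhoSym < 2 := by
  have hsqrt : √3 < 2 := by
    rw [Real.sqrt_lt' two_pos]
    norm_num
  rw [sinh_rhoSym]
  nlinarith [rhoSym_lt, rhoSym_pos]

theorem tendsto_Csym_mul_pow_div_factorial :
    Tendsto (fun m : ℕ => ((2 * m : ℕ) : ℝ) * (Csym (2 * m) * rhoSym ^ (2 * m) / (2 * m)!))
      atTop (nhds 2) := by
  simp only [Csym_eq_cyclicPartitionSum]
  refine mod_cast tendsto_cyclicPartitionSum_mul_pow_div_factorial two_ne_zero (fun n => ?_) ?_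
    (fun n hn => ?_) rhoSym_pos.le ?_ (hasSum_mul_evenWeight_mul_pow_div_factorial rhoSym)
    rhoSym_div_two_mul_sinh_lt_two
  · unfold evenWeight
    positivity
  · simp [evenWeight]
  · simp [evenWeight, even_iff_two_dvd, hn]
  · convert! hasSum_evenWeight_mul_pow_div_factorial rhoSym
    norm_num [cosh_rhoSym]

theorem Csym_isEquivalent :
    (fun m : ℕ => (Csym (2 * m) : ℝ)) ~[atTop]
      (fun m : ℕ => 2 * ((2 * m - 1)! : ℝ) / rhoSym ^ (2 * m)) := by
  have hρ := rhoSym_pos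
  refine isEquivalent_of_tendsto_one ?_
  have hlim := tendsto_Csym_mul_pow_div_factorial.div_const 2
  rw [div_self two_ne_zero] at hlim
  refine hlim.congr' ?_
  filter_upwards [eventually_ne_atTop 0] with m hm
  rw [← Nat.mul_factorial_pred (n := 2 * m) (by positivity), Pi.div_apply]
  push_cast
  field_simp

end Asymptotics

section Cumulant

open Finset

variable {Ω : Type*} [MeasurableSpace Ω] {μ : Measure Ω} {X : Ω → ℝ}

theorem moment_eq_zero_of_odd (hX : IdentDistrib X (fun ω => -X ω) μ μ) {k : ℕ} (hk : Odd k) :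
    moment X k μ = 0 := by
  have hneg : moment X k μ = -moment X k μ := by
    have h := (hX.comp (u := fun x : ℝ => x ^ k) (by fun_prop)).integral_eq
    simpa only [moment, Pi.pow_apply, Function.comp_def, hk.neg_pow, integral_neg] using h
  exact self_eq_neg.1 hneg

theorem prod_moment_parts_eq_zero_of_odd (hX : IdentDistrib X (fun ω => -X ω) μ μ)
    {α : Type*} [DecidableEq α] {s : Finset α} {π : Finpartition s}
    (hπ : ∃ B ∈ π.parts, Odd #B) : ∏ B ∈ π.parts, moment X #B μ = 0 :=
  let ⟨_, hB, hodd⟩ := hπ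
  prod_eq_zero hB (moment_eq_zero_of_odd hX hodd)

theorem exists_mem_parts_odd_card {α : Type*} [DecidableEq α] {s : Finset α} (hs : Odd #s)
    (π : Finpartition s) : ∃ B ∈ π.parts, Odd #B := by
  contrapose! hs
  rw [Nat.not_odd_iff_even, ← π.sum_card_parts]
  exact even_sum _ fun B hB => Nat.not_odd_iff_even.1 (hs B hB)

theorem cumulant_eq_zero_of_odd (hX : IdentDistrib X (fun ω => -X ω) μ μ) {n : ℕ} (hn : Odd n) :
    cumulant X n μ = 0 := by
  refine sum_eq_zero fun π _ => ?_
  have hodd := exists_mem_parts_odd_card (by rwa [card_fin]) π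
  rw [prod_moment_parts_eq_zero_of_odd hX hodd, mul_zero]

variable [IsProbabilityMeasure μ]

theorem abs_moment_le_rpow (hX : AEMeasurable X μ) {k n : ℕ} (hn : n ≠ 0)
    (hkn : k ≤ n) (hint : Integrable (fun ω => |X ω| ^ n) μ) :
    |moment X k μ| ≤ (∫ ω, |X ω| ^ n ∂μ) ^ ((k : ℝ) / n) := by
  have hrpow (ω : Ω) : (|X ω| ^ n) ^ ((k : ℝ) / n) = |X ω| ^ k := by
    rw [← Real.rpow_natCast, ← Real.rpow_mul (abs_nonneg _),
      mul_div_cancel₀ _ (Nat.cast_ne_zero.2 hn), Real.rpow_natCast]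
  have hintk : Integrable (fun ω => |X ω| ^ k) μ :=
    integrable_norm_pow_of_le hX.aestronglyMeasurable hkn hint
  have hjensen := (Real.concaveOn_rpow (p := (k : ℝ) / n) (by positivity)
    (div_le_one_of_le₀ (Nat.cast_le.2 hkn) (Nat.cast_nonneg _))).le_map_integral (μ := μ)
    (f := fun ω => |X ω| ^ n)
    (continuousOn_id.rpow_const fun _ _ => Or.inr (by positivity)) isClosed_Ici
    (ae_of_all _ fun ω => Set.mem_Ici.2 (by positivity)) hint
    (by simpa only [Function.comp_def, hrpow] using hintk)
  calc |moment X k μ| ≤ ∫ ω, |X ω ^ k| ∂μ := abs_integral_le_integral_abs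
    _ = ∫ ω, |X ω| ^ k ∂μ := by simp only [abs_pow]
    _ ≤ _ := by simpa only [hrpow] using hjensen

theorem prod_abs_moment_parts_le (hX : AEMeasurable X μ) {α : Type*} [DecidableEq α]
    {s : Finset α} (hs : s.Nonempty) (hint : Integrable (fun ω => |X ω| ^ #s) μ)
    (π : Finpartition s) : ∏ B ∈ π.parts, |moment X #B μ| ≤ ∫ ω, |X ω| ^ #s ∂μ := by
  have hA : 0 ≤ ∫ ω, |X ω| ^ #s ∂μ := integral_nonneg fun ω => by positivity
  have hs0 : (#s : ℝ) ≠ 0 := Nat.cast_ne_zero.2 hs.card_ne_zero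
  calc ∏ B ∈ π.parts, |moment X #B μ|
      ≤ ∏ B ∈ π.parts, (∫ ω, |X ω| ^ #s ∂μ) ^ ((#B : ℝ) / #s) :=
        prod_le_prod (fun _ _ => abs_nonneg _) fun B hB =>
          abs_moment_le_rpow hX hs.card_ne_zero (card_le_card (π.le hB)) hint
    _ = ∫ ω, |X ω| ^ #s ∂μ := by
        rw [← Real.rpow_sum_of_nonneg hA fun _ _ => by positivity, ← sum_div, ← Nat.cast_sum,
          π.sum_card_parts, div_self hs0, Real.rpow_one]

theorem abs_cumulant_le_Csym_mul_integral (hX : IdentDistrib X (fun ω => -X ω) μ μ) {n : ℕ}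
    (hn : n ≠ 0) (hint : Integrable (fun ω => |X ω| ^ n) μ) :
    |cumulant X n μ| ≤ (Csym n : ℝ) * ∫ ω, |X ω| ^ n ∂μ := by
  rw [Csym, Nat.cast_sum, sum_mul, sum_filter]
  refine (abs_sum_le_sum_abs _ _).trans (sum_le_sum fun π _ => ?_)
  split_ifs with heven
  · have : NeZero n := ⟨hn⟩
    have hprod := prod_abs_moment_parts_le hX.aemeasurable_fst univ_nonempty
      (by rwa [card_fin]) π
    rw [card_fin] at hprod
    rw [abs_mul, abs_mul, abs_neg_one_pow, one_mul, Nat.abs_cast, abs_prod]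
    gcongr
  · push Not at heven
    simp only [Nat.not_even_iff_odd] at heven
    rw [prod_moment_parts_eq_zero_of_odd hX heven, mul_zero, abs_zero]

end Cumulant

theorem theorem3p4 :
    (∀ {Ω : Type*} [MeasurableSpace Ω] (μ : Measure Ω) [IsProbabilityMeasure μ] (X : Ω → ℝ),
      AEMeasurable X μ → IdentDistrib X (fun ω => -X ω) μ μ →
        (∀ n : ℕ, Odd n → Integrable (fun ω => |X ω| ^ n) μ → cumulant X n μ = 0) ∧
        (∀ m : ℕ, 1 ≤ m → Integrable (fun ω => |X ω| ^ (2 * m)) μ →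
          |cumulant X (2 * m) μ| ≤ (Csym (2 * m) : ℝ) * ∫ ω, |X ω| ^ (2 * m) ∂μ)) ∧
    (fun m : ℕ => (Csym (2 * m) : ℝ)) ~[atTop]
      (fun m : ℕ => 2 * ((2 * m - 1)! : ℝ) / rhoSym ^ (2 * m)) ∧
    |rhoSym - 1.317| < 0.0005 := by
  refine ⟨fun μ _ X _ hX => ⟨fun n hn _ => cumulant_eq_zero_of_odd hX hn, fun m hm hint =>
    abs_cumulant_le_Csym_mul_integral hX (by omega) hint⟩, Csym_isEquivalent, ?_⟩
  rw [abs_lt]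
  constructor
  · linarith [lt_rhoSym]
  · linarith [rhoSym_lt]
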